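/- **Theorem 5.3.** Let $\mathbb H^2_+(\mathbb T)\subset L^2(\mathbb T)$ be the Hardy space of functions whose Fourier coefficients with negative index vanish, and let $\mathbf m$ be the Lebesgue measure on the unit circle $\mathbb T$ normalized by $\mathbf m(\mathbb T)=1$. A bounded operator $\mathbf G$ in $\mathbb H^2_+(\mathbb T)$ is called the Hankel operator with symbol $\omega\in L^\infty(\mathbb T)$ if $$(\mathbf G u,u)=\int_{\mathbb T}\omega(\mu)\,u(\bar\mu)\,\overline{u(\mu)}\,d\mathbf m(\mu)\qquad\text{for all }u\in\mathbb H^2_+(\mathbb T).$$ Let $\mathbf G$ be a self-adjoint Hankel operator in $\mathbb H^2_+(\mathbb T)$ with symbol $$\omega(\zeta)=R_1(\zeta)+\sum_{m=2}^{M}R_m(\zeta)(\zeta-\gamma_m)^{-K_m-1},$$ where the numbers $\gamma_m\in\mathbb C$ ($2\le m\le M$) are pairwise distinct, $|\gamma_m|>1$, $K_m\ge 0$ are integers, and $R_1,\dots,R_M$ are complex polynomials with $\deg R_m\le K_m$ and $R_m(\gamma_m)\ne0$ for $m\ge2$; put $K_1=\deg R_1$ if $R_1\neq 0$. Number the $\gamma_m$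 so that, for some $M_0\ge1$ and $M_1\ge0$ with $M_0+M_1\le M$, $\operatorname{Im}\gamma_m=0$ for $2\le m\le M_0$, $\operatorname{Im}\gamma_m<0$ for $M_0+1\le m\le M_0+M_1$, and $\operatorname{Im}\gamma_m>0$ for $M_0+M_1+1\le m\le M$. Set $$\mathsf p_1=R_1^{(K_1)},\qquad \mathsf p_m=-R_m(\gamma_m)\operatorname{sgn}\gamma_m\quad(2\le m\le M_0);$$ these numbers are real because $\mathbf G$ is self-adjoint. For $1\le m\le M_0$ (for $2\le m\le M_0$ if $R_1=0$) define $\mathcal N^{(m)}_\pm$ by $$\begin{aligned} \mathcal N^{(m)}_+=\mathcal N^{(m)}_-&=(K_m+1)/2 &&\text{if }K_m\text{ is odd},\\ \mathcal N^{(m)}_+-1=\mathcal N^{(m)}_-&=K_m/2 &&\text{if }K_m\text{ is even and }\mathsf p_m>0,\\ \mathcal N^{(m)}_+=\mathcal N^{(m)}_--1&=K_m/2 &&\text{if }K_m\text{ is even and }\mathsf p_m<0. \end{aligned}$$ Then the total numbers $N_\pm(\mathbf G)$ of (strictly) positive and negative eigenvalues of $\mathbf G$, counted with multiplicity, are $$N_\pm(\mathbf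 G)=\sum_{m=1}^{M_0}\mathcal N^{(m)}_\pm+\sum_{m=M_0+1}^{M_0+M_1}K_m+M_1,$$ where the first sum starts with $m=2$ if $R_1=0$. -/

import Mathlib

open MeasureTheory AddCircle
open scoped Polynomial ComplexConjugate ENNReal

noncomputable section

/-- `L²(𝕋)`. The unit circle is parametrized by `t ∈ ℝ/ℤ`, `μ = toCircle t = exp(2πit)`, and carries
the Lebesgue measure normalized to have total mass `1`. Complex conjugation `μ ↦ μ̄` is `t ↦ -t`. -/
abbrev L2Circle : Type := Lp ℂ 2 (haarAddCircle : Measure UnitAddCircle)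

lemma fourierCoeff_eq_inner (f : L2Circle) (n : ℤ) :
    fourierCoeff (f : UnitAddCircle → ℂ) n = inner ℂ (fourierLp (T := 1) 2 n) f := by
  rw [← fourierBasis_repr, HilbertBasis.repr_apply_apply, coe_fourierBasis]

/-- The Hardy space `ℍ²₊(𝕋) ⊂ L²(𝕋)`: the functions whose Fourier coefficients of negative index
vanish (the boundary values of the analytic functions `∑_{n ≥ 0} ξₙ zⁿ` with `∑ |ξₙ|² < ∞`). -/
def hardyCircle : Submodule ℂ L2Circle where
  carrier := {f | ∀ n : ℤ, n < 0 → fourierCoeff (f : UnitAddCircle → ℂ) n = 0}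
  zero_mem' := fun n _ => by rw [fourierCoeff_eq_inner, inner_zero_right]
  add_mem' := fun {f g} hf hg n hn => by
    have h1 := hf n hn
    have h2 := hg n hn
    rw [fourierCoeff_eq_inner] at h1 h2 ⊢
    rw [inner_add_right, h1, h2, add_zero]
  smul_mem' := fun c f hf n hn => by
    have h1 := hf n hn
    rw [fourierCoeff_eq_inner] at h1 ⊢
    rw [inner_smul_right, h1, mul_zero]

lemma isClosed_hardyCircle : IsClosed (hardyCircle : Set L2Circle) := by
  have h : (hardyCircle : Set L2Circle) =
      ⋂ n : ℤ, ⋂ _ : n < 0, {f | inner ℂ (fourierLp (T := 1) 2 n) f = 0} := by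
    ext f
    simp only [Set.mem_iInter, Set.mem_ofPred_eq, ← fourierCoeff_eq_inner]
    rfl
  rw [h]
  exact isClosed_iInter fun n => isClosed_iInter fun _ =>
    isClosed_eq (continuous_const.inner continuous_id) continuous_const

instance hardyCircle_completeSpace : CompleteSpace hardyCircle :=
  isClosed_hardyCircle.completeSpace_coe

/-- `G` is the Hankel operator in `ℍ²₊(𝕋)` with symbol `ω ∈ L^∞(𝕋)`: its quadratic form is
`(G u, u) = ∫_𝕋 ω(μ) u(μ̄) conj(u(μ)) dm(μ)`. The symbol is given as a function of `μ ∈ ℂ`, of which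
only the values on the unit circle matter. -/
structure IsHankelWithSymbol (ω : ℂ → ℂ) (G : hardyCircle →L[ℂ] hardyCircle) : Prop where
  memLp_symbol :
    MemLp (fun t : UnitAddCircle => ω (toCircle t : ℂ)) ∞ haarAddCircle
  form_eq : ∀ u : hardyCircle, inner ℂ u (G u) =
    ∫ t : UnitAddCircle, ω (toCircle t : ℂ) * (u : L2Circle) (-t) * conj ((u : L2Circle) t)
      ∂haarAddCircle

/-- The rational function `ω(ζ) = R₁(ζ) + ∑_{m=2}^M R_m(ζ) (ζ - γ_m)^{-K_m-1}`. -/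
def rationalSymbol (M : ℕ) (K : ℕ → ℕ) (γ : ℕ → ℂ) (R : ℕ → ℂ[X]) (ζ : ℂ) : ℂ :=
  (R 1).eval ζ + ∑ m ∈ Finset.Icc 2 M, (R m).eval ζ * ((ζ - γ m) ^ (K m + 1))⁻¹

section Multiplicity

variable {E : Type*} [NormedAddCommGroup E] [InnerProductSpace ℂ E]

/-- The number, counted with multiplicity, of strictly positive eigenvalues: the dimension of the
span of all eigenvectors with strictly positive eigenvalue. -/
def numPosEigenvalues (A : E →L[ℂ] E) : Cardinal :=
  Module.rank ℂ
    (⨆ (x : ℝ) (_ : 0 < x), Module.End.eigenspace (A : E →ₗ[ℂ] E) (x : ℂ) : Submodule ℂ E)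

/-- The number, counted with multiplicity, of strictly negative eigenvalues. -/
def numNegEigenvalues (A : E →L[ℂ] E) : Cardinal :=
  Module.rank ℂ
    (⨆ (x : ℝ) (_ : x < 0), Module.End.eigenspace (A : E →ₗ[ℂ] E) (x : ℂ) : Submodule ℂ E)

end Multiplicity

/-- `𝒩₊` for degree `K` and leading number `p ≠ 0`. -/
def calNPos (K : ℕ) (p : ℝ) : ℕ :=
  if Odd K then (K + 1) / 2 else if 0 < p then K / 2 + 1 else K / 2

/-- `𝒩₋` for degree `K` and leading number `p ≠ 0`. -/
def calNNeg (K : ℕ) (p : ℝ) : ℕ :=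
  if Odd K then (K + 1) / 2 else if p < 0 then K / 2 + 1 else K / 2

/-- `p₁ = R₁^{(K₁)}` (a constant if `K₁ = deg R₁`), and `p_m = -R_m(γ_m) sgn γ_m` for a real `γ_m`,
`m ≥ 2`. These numbers are real if the operator is self-adjoint, so that taking real parts
does not change them. -/
def leadingNumber (K : ℕ → ℕ) (γ : ℕ → ℂ) (R : ℕ → ℂ[X]) (m : ℕ) : ℝ :=
  if m = 1 then ((Polynomial.derivative^[K 1] (R 1)).eval 0).re
  else -((R m).eval (γ m)).re * Real.sign (γ m).re

open Classical in
/-- The index at which the sum over the real terms starts: `1`, or `2` if `R₁ = 0`. -/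
def firstRealIndex (R : ℕ → ℂ[X]) : ℕ := if R 1 = 0 then 2 else 1

end

/-!
On polynomials the quadratic form of `G` is `(G p, p) = Λ (p p̄)`, where `p̄` has the conjugate
coefficients and, by Cauchy's formula, `Λ f` is the sum of the residues of `w⁻¹ ω(w⁻¹) f(w)` in the
unit disc. Its poles `z_m` are `0` and the points `1 / γ_m`, of order `K_m + 1`; self-adjointness
makes them come in conjugate pairs of equal order. The form is nonnegative on the multiples of
`∏ (X - z_m) ^ b_m` as soon as each non-real pair is cancelled at one of its two points and each
real pole is cancelled up to order `𝒩₋`. The degree `∑ b_m` of this product therefore bounds the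
number of negative eigenvalues, and the same argument for `-G` bounds the number of positive ones.
The sum of the two bounds is at most `∑ (K_m + 1)`, which is at most the rank of `G` because `Λ`
annihilates no ideal larger than the one generated by `∏ (X - z_m) ^ (K_m + 1)`; hence both bounds
are sharp.
-/

section Inertia

variable {E : Type*} [NormedAddCommGroup E] [InnerProductSpace ℂ E] {A : E →L[ℂ] E}

lemma numPosEigenvalues_eq_numNegEigenvalues_neg (A : E →L[ℂ] E) :
    numPosEigenvalues A = numNegEigenvalues (-A) := by
  have eigenspace_neg (x : ℝ) :
      Module.End.eigenspace ((-A : E →L[ℂ] E) : E →ₗ[ℂ] E) ((-x : ℝ) : ℂ) =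
        Module.End.eigenspace (A : E →ₗ[ℂ] E) (x : ℂ) := by
    ext u
    simp only [Module.End.mem_eigenspace_iff, ContinuousLinearMap.coe_coe,
      neg_apply, Complex.ofReal_neg, neg_smul, neg_inj]
  refine congrArg (fun F : Submodule ℂ E ↦ Module.rank ℂ F) ((Equiv.neg ℝ).iSup_congr fun x ↦ ?_)
  simp only [Equiv.neg_apply, neg_lt_zero, eigenspace_neg]

lemma re_inner_neg_of_mem_iSup_eigenspace (hA : (A : E →ₗ[ℂ] E).IsSymmetric) {u : E}
    (hu : u ∈ ⨆ (x : ℝ) (_ : x < 0), Module.End.eigenspace (A : E →ₗ[ℂ] E) (x : ℂ)) (hu0 : u ≠ 0) :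
    (inner ℂ u (A u)).re < 0 := by
  classical
  have horth : OrthogonalFamily ℂ
      (fun x : {x : ℝ // x < 0} ↦ Module.End.eigenspace (A : E →ₗ[ℂ] E) ((x : ℝ) : ℂ))
      fun x ↦ (Module.End.eigenspace (A : E →ₗ[ℂ] E) ((x : ℝ) : ℂ)).subtypeₗᵢ :=
    hA.orthogonalFamily_eigenspaces.comp
      (Complex.ofReal_injective.comp Subtype.val_injective)
  rw [iSup_subtype'] at hu
  obtain ⟨f, rfl⟩ := (Submodule.mem_iSup_iff_exists_dfinsupp' _ u).1 hu
  change ∑ x ∈ f.support, (f x : E) ≠ 0 at hu0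
  change (inner ℂ (∑ x ∈ f.support, (f x : E)) (A (∑ x ∈ f.support, (f x : E)))).re < 0
  have map_sum_eq : A (∑ x ∈ f.support, (f x : E)) =
      ∑ x ∈ f.support, ((((x : ℝ) : ℂ) • f x :
        Module.End.eigenspace (A : E →ₗ[ℂ] E) ((x : ℝ) : ℂ)) : E) := by
    rw [map_sum]
    exact Finset.sum_congr rfl fun x _ ↦ Module.End.mem_eigenspace_iff.1 (f x).2
  have form_eq : inner ℂ (∑ x ∈ f.support, (f x : E)) (A (∑ x ∈ f.support, (f x : E))) =
      ∑ x ∈ f.support, (((x : ℝ) * ‖f x‖ ^ 2 : ℝ) : ℂ) := by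
    rw [map_sum_eq]
    refine (horth.inner_sum (fun x ↦ f x) (fun x ↦ ((x : ℝ) : ℂ) • f x) f.support).trans ?_
    refine Finset.sum_congr rfl fun x _ ↦ ?_
    rw [inner_smul_right, inner_self_eq_norm_sq_to_K]
    push_cast
    rfl
  rw [form_eq, ← Complex.ofReal_sum, Complex.ofReal_re]
  refine Finset.sum_neg (fun x hx ↦ ?_) (Finset.nonempty_of_sum_ne_zero hu0)
  have : 0 < ‖f x‖ := norm_pos_iff.2 (DFinsupp.mem_support_iff.1 hx)
  exact mul_neg_of_neg_of_pos x.2 (by positivity)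

lemma rank_le_rank_of_disjoint_of_codisjoint {R V : Type*} [Ring R] [AddCommGroup V] [Module R V]
    {F N W : Submodule R V} (hFN : Disjoint F N) (hNW : Codisjoint N W) :
    Module.rank R F ≤ Module.rank R W := by
  have hinj : Function.Injective (N.mkQ.domRestrict F) := by
    rwa [LinearMap.injective_domRestrict_iff, Submodule.ker_mkQ]
  have hsurj : Function.Surjective (N.mkQ.domRestrict W) := by
    rw [← LinearMap.range_eq_top, LinearMap.range_domRestrict, Submodule.map_mkQ_eq_top]
    exact hNW.eq_top
  exact (LinearMap.rank_le_of_injective _ hinj).trans (LinearMap.rank_le_of_surjective _ hsurj)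

lemma numNegEigenvalues_le_rank (hA : (A : E →ₗ[ℂ] E).IsSymmetric) {N W : Submodule ℂ E}
    (hN : ∀ u ∈ N, 0 ≤ (inner ℂ u (A u)).re) (hNW : Codisjoint N W) :
    numNegEigenvalues A ≤ Module.rank ℂ W := by
  refine rank_le_rank_of_disjoint_of_codisjoint (Submodule.disjoint_def.2 fun u hu huN ↦ ?_) hNW
  by_contra hu0
  exact (re_inner_neg_of_mem_iSup_eigenspace hA hu hu0).not_ge (hN u huN)

lemma exists_real_eigenvalue_ne_zero_of_mem_range (hA : (A : E →ₗ[ℂ] E).IsSymmetric) {x : ℂ} {v : E}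
    (hv : A v = x • v) (hv0 : v ≠ 0) (hmem : v ∈ LinearMap.range (A : E →ₗ[ℂ] E)) :
    ∃ r : ℝ, r ≠ 0 ∧ (r : ℂ) = x := by
  obtain ⟨r, rfl⟩ := Complex.conj_eq_iff_real.1 (hA.conj_eigenvalue_eq_self
    (Module.End.hasEigenvalue_of_hasEigenvector ⟨Module.End.mem_eigenspace_iff.2 hv, hv0⟩))
  refine ⟨r, ?_, rfl⟩
  rintro rfl
  obtain ⟨w, rfl⟩ := hmem
  refine hv0 (inner_self_eq_zero (𝕜 := ℂ).1 ?_)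
  rw [hA w]
  simp_all

lemma range_le_iSup_eigenspace_pos_sup_neg (hA : (A : E →ₗ[ℂ] E).IsSymmetric)
    [FiniteDimensional ℂ (LinearMap.range (A : E →ₗ[ℂ] E))] :
    LinearMap.range (A : E →ₗ[ℂ] E) ≤
      (⨆ (x : ℝ) (_ : 0 < x), Module.End.eigenspace (A : E →ₗ[ℂ] E) (x : ℂ)) ⊔
        ⨆ (x : ℝ) (_ : x < 0), Module.End.eigenspace (A : E →ₗ[ℂ] E) (x : ℂ) := by
  set F := LinearMap.range (A : E →ₗ[ℂ] E)
  have hinv : ∀ v ∈ F, (A : E →ₗ[ℂ] E) v ∈ F := fun v _ ↦ LinearMap.mem_range_self _ v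
  set B := (A : E →ₗ[ℂ] E).restrict hinv
  have hB : B.IsSymmetric := hA.restrict_invariant hinv
  have iSup_eigenspace_eq_top : ⨆ x : ℂ, Module.End.eigenspace B x = ⊤ := by
    rw [← Submodule.orthogonal_eq_bot_iff]
    exact hB.orthogonalComplement_iSup_eigenspaces_eq_bot
  rw [← Submodule.range_subtype F, LinearMap.range_eq_map, ← iSup_eigenspace_eq_top,
    Submodule.map_iSup]
  refine iSup_le fun x ↦ ?_
  rintro _ ⟨v, hv, rfl⟩
  rcases eq_or_ne (v : E) 0 with hv0 | hv0
  · simp [hv0]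
  have hAv : A v = x • (v : E) := congrArg Subtype.val (Module.End.mem_eigenspace_iff.1 hv)
  obtain ⟨r, hr, rfl⟩ := exists_real_eigenvalue_ne_zero_of_mem_range hA hAv hv0 v.2
  have hmem := Module.End.mem_eigenspace_iff.2 hAv
  rcases hr.lt_or_gt with hneg | hpos
  · exact Submodule.mem_sup_right
      (Submodule.mem_iSup_of_mem r (Submodule.mem_iSup_of_mem hneg hmem))
  · exact Submodule.mem_sup_left
      (Submodule.mem_iSup_of_mem r (Submodule.mem_iSup_of_mem hpos hmem))

lemma rank_range_le_numPosEigenvalues_add_numNegEigenvalues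
    (hA : (A : E →ₗ[ℂ] E).IsSymmetric) [FiniteDimensional ℂ (LinearMap.range (A : E →ₗ[ℂ] E))] :
    Module.rank ℂ (LinearMap.range (A : E →ₗ[ℂ] E)) ≤
      numPosEigenvalues A + numNegEigenvalues A :=
  (Submodule.rank_mono (range_le_iSup_eigenspace_pos_sup_neg hA)).trans
    (Submodule.rank_add_le_rank_add_rank _ _)

end Inertia

section Residue

open Polynomial

variable {ι k : Type*} {s : Finset ι} {K b : ι → ℕ} {n : ℕ}

section CommRing

variable [CommRing k] {z : k} {Q : k[X]}

/-- The monic polynomial with a zero of order `b m` at the node `z m` for each `m ∈ s`. -/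
noncomputable def nodePolynomial (s : Finset ι) (z : ι → k) (b : ι → ℕ) : k[X] :=
  ∏ m ∈ s, (X - C (z m)) ^ b m

lemma monic_nodePolynomial (s : Finset ι) (z : ι → k) (b : ι → ℕ) :
    (nodePolynomial s z b).Monic :=
  monic_prod_of_monic _ _ fun m _ ↦ (monic_X_sub_C (z m)).pow _

lemma natDegree_nodePolynomial [Nontrivial k] (s : Finset ι) (z : ι → k) (b : ι → ℕ) :
    (nodePolynomial s z b).natDegree = ∑ m ∈ s, b m := by
  rw [nodePolynomial, natDegree_prod_of_monic _ _ fun m _ ↦ (monic_X_sub_C (z m)).pow _]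
  simp only [(monic_X_sub_C _).natDegree_pow, natDegree_X_sub_C, mul_one]

lemma pow_dvd_nodePolynomial (z : ι → k) (b : ι → ℕ) {m : ι} (hm : m ∈ s) :
    (X - C (z m)) ^ b m ∣ nodePolynomial s z b :=
  Finset.dvd_prod_of_mem _ hm

lemma map_nodePolynomial {l : Type*} [CommRing l] (φ : k →+* l) (s : Finset ι) (z : ι → k)
    (b : ι → ℕ) : (nodePolynomial s z b).map φ = nodePolynomial s (φ ∘ z) b := by
  rw [nodePolynomial, nodePolynomial]
  simp only [Polynomial.map_prod, Polynomial.map_pow, Polynomial.map_sub, map_X, map_C,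
    Function.comp_apply]

lemma countP_roots_nodePolynomial [IsDomain k] (s : Finset ι) (z : ι → k) (b : ι → ℕ)
    (p : k → Prop) [DecidablePred p] :
    (nodePolynomial s z b).roots.countP p = ∑ m ∈ s with p (z m), b m := by
  have hroots : (nodePolynomial s z b).roots = ∑ m ∈ s, b m • {z m} := by
    rw [nodePolynomial, roots_prod _ _ (monic_nodePolynomial s z b).ne_zero]
    simp only [roots_pow, roots_X_sub_C]
    rfl
  rw [hroots, ← Multiset.coe_countPAddMonoidHom, map_sum, Finset.sum_filter]
  refine Finset.sum_congr rfl fun m _ ↦ ?_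
  simp [Multiset.countP_nsmul, ← Multiset.cons_zero, Multiset.countP_cons]

/-- The residue at `z` of `Q f / (X - z) ^ (n + 1)`, as a functional of the polynomial `f`; it is
the `n`-th Taylor coefficient of `Q f` at `z`. -/
noncomputable def residueFunctional (z : k) (n : ℕ) (Q : k[X]) : k[X] →ₗ[k] k :=
  lcoeff k n ∘ₗ taylor z ∘ₗ LinearMap.mulLeft k Q

lemma residueFunctional_apply (z : k) (n : ℕ) (Q f : k[X]) :
    residueFunctional z n Q f = (taylor z (Q * f)).coeff n := rfl

lemma residueFunctional_neg (z : k) (n : ℕ) (Q : k[X]) :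
    residueFunctional z n (-Q) = -residueFunctional z n Q := by
  refine LinearMap.ext fun f ↦ ?_
  simp [residueFunctional_apply]

lemma residueFunctional_mul_X_sub_C_pow (z : k) (Q f : k[X]) {i : ℕ} (hi : i ≤ n) :
    residueFunctional z n Q (f * (X - C z) ^ (n - i)) = (taylor z (Q * f)).coeff i := by
  rw [residueFunctional_apply, ← mul_assoc, taylor_mul, taylor_pow, map_sub, taylor_X, taylor_C,
    add_sub_cancel_right, coeff_mul_X_pow', if_pos (Nat.sub_le n i), Nat.sub_sub_self hi]

lemma residueFunctional_X_sub_C_pow_mul (z : k) (n : ℕ) (Q g : k[X]) :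
    residueFunctional z n Q ((X - C z) ^ n * g) = Q.eval z * g.eval z := by
  simpa [mul_comm g] using residueFunctional_mul_X_sub_C_pow z Q g (Nat.zero_le n)

lemma residueFunctional_eq_zero_of_dvd {f : k[X]} (hf : (X - C z) ^ (n + 1) ∣ f) :
    residueFunctional z n Q f = 0 := by
  obtain ⟨g, rfl⟩ := hf
  rw [pow_succ, mul_assoc, residueFunctional_X_sub_C_pow_mul]
  simp

lemma pow_dvd_of_forall_residueFunctional_mul_eq_zero [IsDomain k] (hQ : Q.eval z ≠ 0) {f : k[X]}
    (hf : ∀ g, residueFunctional z n Q (f * g) = 0) : (X - C z) ^ (n + 1) ∣ f := by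
  refine (prime_X_sub_C z).pow_dvd_of_dvd_mul_left _ (mt dvd_iff_isRoot.1 hQ) (a := Q) ?_
  rw [X_sub_C_pow_dvd_iff, ← taylor_apply, X_pow_dvd_iff]
  intro i hi
  rw [← residueFunctional_mul_X_sub_C_pow z Q f (Nat.lt_succ_iff.1 hi)]
  exact hf _

/-- The functional `f ↦ ∑ m ∈ s, Res_{z m} Q m f / (X - z m) ^ (K m + 1)`. -/
noncomputable def residueSum (s : Finset ι) (z : ι → k) (K : ι → ℕ) (Q : ι → k[X]) : k[X] →ₗ[k] k :=
  ∑ m ∈ s, residueFunctional (z m) (K m) (Q m)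

lemma residueSum_apply (s : Finset ι) (z : ι → k) (K : ι → ℕ) (Q : ι → k[X]) (f : k[X]) :
    residueSum s z K Q f = ∑ m ∈ s, residueFunctional (z m) (K m) (Q m) f :=
  LinearMap.sum_apply _ _ _

lemma residueSum_neg (s : Finset ι) (z : ι → k) (K : ι → ℕ) (Q : ι → k[X]) :
    residueSum s z K (-Q) = -residueSum s z K Q := by
  simp only [residueSum, Pi.neg_apply, residueFunctional_neg, Finset.sum_neg_distrib]

lemma residueSum_eq_zero_of_nodePolynomial_dvd {z : ι → k} (Q : ι → k[X]) {f : k[X]}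
    (hf : nodePolynomial s z (K · + 1) ∣ f) : residueSum s z K Q f = 0 := by
  rw [residueSum_apply]
  exact Finset.sum_eq_zero fun m hm ↦
    residueFunctional_eq_zero_of_dvd ((pow_dvd_nodePolynomial z (K · + 1) hm).trans hf)

end CommRing

variable [Field k] {z : ι → k} {Q : ι → k[X]}

lemma nodePolynomial_dvd_of_forall_pow_dvd (hz : Set.InjOn z s) {f : k[X]}
    (hf : ∀ m ∈ s, (X - C (z m)) ^ b m ∣ f) : nodePolynomial s z b ∣ f :=
  Finset.prod_dvd_of_coprime (fun _ hi _ hj hij ↦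
    (isCoprime_X_sub_C_of_isUnit_sub (sub_ne_zero_of_ne (hz.ne hi hj hij)).isUnit).pow) hf

lemma nodePolynomial_dvd_of_forall_residueSum_mul_eq_zero (hz : Set.InjOn z s)
    (hQ : ∀ m ∈ s, (Q m).eval (z m) ≠ 0) {f : k[X]} (hf : ∀ g, residueSum s z K Q (f * g) = 0) :
    nodePolynomial s z (K · + 1) ∣ f := by
  classical
  refine nodePolynomial_dvd_of_forall_pow_dvd hz fun m hm ↦ ?_
  let P := nodePolynomial (s.erase m) z (K · + 1)
  have eval_ne_zero : (Q m * P).eval (z m) ≠ 0 := by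
    simp only [P, nodePolynomial, eval_mul, eval_prod]
    refine mul_ne_zero (hQ m hm) (Finset.prod_ne_zero_iff.2 ?_)
    intro i hi
    have : z m ≠ z i := hz.ne hm (Finset.mem_of_mem_erase hi) (Finset.ne_of_mem_erase hi).symm
    simp [sub_ne_zero.2 this]
  refine pow_dvd_of_forall_residueFunctional_mul_eq_zero eval_ne_zero (n := K m) fun g ↦ ?_
  -- Multiplication by `P` kills all residues except the one at `z m`.
  have residue_eq : residueSum s z K Q (f * (P * g)) =
      residueFunctional (z m) (K m) (Q m) (f * (P * g)) := by
    rw [residueSum_apply, ← Finset.add_sum_erase s _ hm, ← residueSum_apply,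
      residueSum_eq_zero_of_nodePolynomial_dvd Q ((dvd_mul_right P g).mul_left f), add_zero]
  rw [← hf (P * g), residue_eq]
  simp only [residueFunctional_apply]
  congr 2
  ring

lemma sum_filter_conj_eq_of_residueSum_map_conj [StarRing k] (hz : Set.InjOn z s)
    (hQ : ∀ m ∈ s, (Q m).eval (z m) ≠ 0)
    (hreal : ∀ f, residueSum s z K Q (f.map (starRingEnd k)) = conj (residueSum s z K Q f))
    (p : k → Prop) [DecidablePred p] :
    ∑ m ∈ s with p (conj (z m)), (K m + 1) = ∑ m ∈ s with p (z m), (K m + 1) := by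
  set A := nodePolynomial s z (K · + 1)
  have hdvd : A ∣ A.map (starRingEnd k) := by
    refine nodePolynomial_dvd_of_forall_residueSum_mul_eq_zero hz hQ fun g ↦ ?_
    have hg : A.map (starRingEnd k) * g = (A * g.map (starRingEnd k)).map (starRingEnd k) := by
      simp [Polynomial.map_mul, Polynomial.map_map]
    rw [hg, hreal, residueSum_eq_zero_of_nodePolynomial_dvd Q (dvd_mul_right _ _), map_zero]
  have hA := monic_nodePolynomial s z (K · + 1)
  have map_conj_eq : A.map (starRingEnd k) = A :=
    eq_of_monic_of_dvd_of_natDegree_le hA (hA.map _) hdvd natDegree_map_le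
  rw [← countP_roots_nodePolynomial s z (K · + 1) p]
  change _ = A.roots.countP p
  rw [← map_conj_eq, map_nodePolynomial, countP_roots_nodePolynomial]
  rfl

end Residue

section RealResidue

open Polynomial

lemma calNNeg_neg (n : ℕ) (p : ℝ) : calNNeg n (-p) = calNPos n p := by
  simp only [calNNeg, calNPos, neg_lt_zero]

lemma calNPos_add_calNNeg_le (n : ℕ) (p : ℝ) : calNPos n p + calNNeg n p ≤ n + 1 := by
  unfold calNPos calNNeg
  split_ifs with _ hpos hneg
  · omega
  · exact absurd hneg hpos.not_gt
  all_goals omega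

lemma lt_two_mul_calNNeg_or_eq (n : ℕ) (p : ℝ) :
    n + 1 ≤ 2 * calNNeg n p ∨ n = 2 * calNNeg n p ∧ 0 ≤ p := by
  rcases n.even_or_odd with hn | hn
  · have := Nat.two_mul_div_two_of_even hn
    rcases lt_or_ge p 0 with hp | hp
    · left
      simp only [calNNeg, Nat.not_odd_iff_even.2 hn, hp, if_true, if_false]
      omega
    · right
      simp only [calNNeg, Nat.not_odd_iff_even.2 hn, hp.not_gt, hp, if_false, and_true]
      omega
  · have := Nat.two_mul_div_two_of_even hn.add_one
    left
    simp only [calNNeg, hn, if_true]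
    omega

lemma X_sub_C_conj_pow_dvd_map_conj {k : Type*} [CommRing k] [StarRing k] {z : k} {n : ℕ}
    {f : k[X]} (hf : (X - C z) ^ n ∣ f) : (X - C (conj z)) ^ n ∣ f.map (starRingEnd k) := by
  simpa using Polynomial.map_dvd (starRingEnd k) hf

lemma re_residueFunctional_mul_map_conj_nonneg {z : ℂ} (hz : z.im = 0) {n : ℕ} {Q f : ℂ[X]}
    (hf : (X - C z) ^ calNNeg n (Q.eval z).re ∣ f) :
    0 ≤ (residueFunctional z n Q (f * f.map (starRingEnd ℂ))).re := by
  have hzz : conj z = z := Complex.conj_eq_iff_im.2 hz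
  rcases lt_two_mul_calNNeg_or_eq n (Q.eval z).re with hn | ⟨hn, hQ⟩
  · rw [residueFunctional_eq_zero_of_dvd, Complex.zero_re]
    refine (pow_dvd_pow _ hn).trans ?_
    rw [two_mul, pow_add]
    refine mul_dvd_mul hf ?_
    simpa only [hzz] using X_sub_C_conj_pow_dvd_map_conj hf
  · have pow_eq : (X - C z) ^ n =
        (X - C z) ^ calNNeg n (Q.eval z).re * (X - C z) ^ calNNeg n (Q.eval z).re := by
      rw [← pow_add, ← two_mul, ← hn]
    obtain ⟨g, hg⟩ := hf
    have mul_conj_eq : f * f.map (starRingEnd ℂ) =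
        (X - C z) ^ n * (g * g.map (starRingEnd ℂ)) := by
      simp only [hg, pow_eq, Polynomial.map_mul, Polynomial.map_pow, Polynomial.map_sub, map_X,
        map_C, hzz]
      ring
    have eval_conj : (g.map (starRingEnd ℂ)).eval z = conj (g.eval z) := by
      rw [← eval_map_apply, hzz]
    rw [mul_conj_eq, residueFunctional_X_sub_C_pow_mul, eval_mul, eval_conj, Complex.mul_conj,
      Complex.re_mul_ofReal]
    exact mul_nonneg hQ (Complex.normSq_nonneg _)

/-- The order of vanishing prescribed at the node `z` in order that the residue form
`f ↦ Res_z Q f f̄ / (X - z) ^ (n + 1)` contributes nonnegatively. Nonreal nodes come in conjugate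
pairs, and the full order `n + 1` at the node in the upper half-plane kills both contributions. -/
noncomputable def nodeExponent (z : ℂ) (n : ℕ) (Q : ℂ[X]) : ℕ :=
  if z.im = 0 then calNNeg n (Q.eval z).re else if 0 < z.im then n + 1 else 0

variable {ι : Type*} {s : Finset ι} {z : ι → ℂ} {K : ι → ℕ} {Q : ι → ℂ[X]}

lemma sum_nodeExponent (s : Finset ι) (z : ι → ℂ) (K : ι → ℕ) (Q : ι → ℂ[X]) :
    ∑ m ∈ s, nodeExponent (z m) (K m) (Q m) =
      ∑ m ∈ s with (z m).im = 0, calNNeg (K m) ((Q m).eval (z m)).re +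
        ∑ m ∈ s with 0 < (z m).im, (K m + 1) := by
  rw [Finset.sum_filter, Finset.sum_filter, ← Finset.sum_add_distrib]
  refine Finset.sum_congr rfl fun m _ ↦ ?_
  rcases eq_or_ne (z m).im 0 with h | h <;> simp [nodeExponent, h]

lemma X_sub_C_conj_pow_dvd_of_nodePolynomial_dvd (hz : Set.InjOn z s)
    (hQ : ∀ m ∈ s, (Q m).eval (z m) ≠ 0)
    (hreal : ∀ f, residueSum s z K Q (f.map (starRingEnd ℂ)) = conj (residueSum s z K Q f))
    {f : ℂ[X]} (hf : nodePolynomial s z (fun m ↦ nodeExponent (z m) (K m) (Q m)) ∣ f)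
    {m : ι} (hm : m ∈ s) (him : (z m).im < 0) : (X - C (conj (z m))) ^ (K m + 1) ∣ f := by
  classical
  refine dvd_trans ?_ hf
  rw [← le_rootMultiplicity_iff (monic_nodePolynomial ..).ne_zero, ← count_roots, Multiset.count,
    countP_roots_nodePolynomial]
  calc K m + 1 ≤ ∑ i ∈ s with conj (z m) = conj (z i), (K i + 1) :=
        Finset.single_le_sum (f := (K · + 1)) (fun _ _ ↦ Nat.zero_le _) (by simp [hm])
    _ = ∑ i ∈ s with conj (z m) = z i, (K i + 1) :=
        sum_filter_conj_eq_of_residueSum_map_conj hz hQ hreal (conj (z m) = ·)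
    _ = ∑ i ∈ s with conj (z m) = z i, nodeExponent (z i) (K i) (Q i) := by
        refine Finset.sum_congr rfl fun i hi ↦ ?_
        have : 0 < (z i).im := by
          rw [← (Finset.mem_filter.1 hi).2, Complex.conj_im]
          exact neg_pos.2 him
        rw [nodeExponent, if_neg this.ne', if_pos this]

lemma re_residueSum_mul_map_conj_nonneg (hz : Set.InjOn z s)
    (hQ : ∀ m ∈ s, (Q m).eval (z m) ≠ 0)
    (hreal : ∀ f, residueSum s z K Q (f.map (starRingEnd ℂ)) = conj (residueSum s z K Q f))
    {f : ℂ[X]} (hf : nodePolynomial s z (fun m ↦ nodeExponent (z m) (K m) (Q m)) ∣ f) :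
    0 ≤ (residueSum s z K Q (f * f.map (starRingEnd ℂ))).re := by
  rw [residueSum_apply, Complex.re_sum]
  refine Finset.sum_nonneg fun m hm ↦ ?_
  have hdvd : (X - C (z m)) ^ nodeExponent (z m) (K m) (Q m) ∣ f :=
    (pow_dvd_nodePolynomial z (fun m ↦ nodeExponent (z m) (K m) (Q m)) hm).trans hf
  rcases lt_trichotomy (z m).im 0 with him | him | him
  · have hconj := X_sub_C_conj_pow_dvd_map_conj
      (X_sub_C_conj_pow_dvd_of_nodePolynomial_dvd hz hQ hreal hf hm him)
    rw [Complex.conj_conj] at hconj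
    rw [residueFunctional_eq_zero_of_dvd (hconj.mul_left f), Complex.zero_re]
  · rw [nodeExponent, if_pos him] at hdvd
    exact re_residueFunctional_mul_map_conj_nonneg him hdvd
  · rw [nodeExponent, if_neg him.ne', if_pos him] at hdvd
    rw [residueFunctional_eq_zero_of_dvd (hdvd.mul_right _), Complex.zero_re]

lemma sum_add_one_eq_of_residueSum_map_conj (hz : Set.InjOn z s)
    (hQ : ∀ m ∈ s, (Q m).eval (z m) ≠ 0)
    (hreal : ∀ f, residueSum s z K Q (f.map (starRingEnd ℂ)) = conj (residueSum s z K Q f)) :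
    ∑ m ∈ s, (K m + 1) =
      ∑ m ∈ s with (z m).im = 0, (K m + 1) + 2 * ∑ m ∈ s with 0 < (z m).im, (K m + 1) := by
  have hpair := sum_filter_conj_eq_of_residueSum_map_conj hz hQ hreal (0 < ·.im)
  simp only [Complex.conj_im, Left.neg_pos_iff] at hpair
  nth_rw 1 [two_mul, ← hpair]
  simp only [Finset.sum_filter, ← Finset.sum_add_distrib]
  refine Finset.sum_congr rfl fun m _ ↦ ?_
  rcases lt_trichotomy (z m).im 0 with h | h | h <;> grind

end RealResidue

section Model

open Polynomial

variable {H : Type*} [NormedAddCommGroup H] [InnerProductSpace ℂ H]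
  {Φ : ℂ[X] →ₗ[ℂ] H} {G : H →L[ℂ] H} {Λ : ℂ[X] →ₗ[ℂ] ℂ}

/-- `G` is a Hankel operator in the polynomial model `Φ` with functional `Λ`: the polynomials are
dense in the inner product space `H` through `Φ`, and the form `⟨p, G r⟩ = Λ (r p̄)` depends only on
`r p̄`, where `p̄` is the polynomial with the conjugate coefficients. -/
structure IsHankelModel (Φ : ℂ[X] →ₗ[ℂ] H) (G : H →L[ℂ] H) (Λ : ℂ[X] →ₗ[ℂ] ℂ) : Prop where
  denseRange : DenseRange Φ
  inner_apply : ∀ p r, inner ℂ (Φ p) (G (Φ r)) = Λ (r * p.map (starRingEnd ℂ))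

lemma closure_map_span_sup_map_degreeLT (hΦ : DenseRange Φ) {D : ℂ[X]} (hD : D.Monic) :
    (((Ideal.span {D}).restrictScalars ℂ).map Φ).topologicalClosure ⊔
      (degreeLT ℂ D.natDegree).map Φ = ⊤ := by
  set N := (((Ideal.span {D}).restrictScalars ℂ).map Φ).topologicalClosure
  have : FiniteDimensional ℂ (degreeLT ℂ D.natDegree) :=
    (degreeLTEquiv ℂ D.natDegree).symm.finiteDimensional
  have hclosed : IsClosed ((N ⊔ (degreeLT ℂ D.natDegree).map Φ : Submodule ℂ H) : Set H) :=
    Submodule.isClosed_sup_finiteDimensional _ _ (Submodule.isClosed_topologicalClosure _)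
  rw [← hclosed.submodule_topologicalClosure_eq, ← Submodule.dense_iff_topologicalClosure_eq_top]
  refine hΦ.mono ?_
  rintro _ ⟨f, rfl⟩
  rw [← modByMonic_add_div f D, map_add, add_comm]
  refine Submodule.add_mem_sup ?_ (Submodule.mem_map_of_mem ?_)
  · exact Submodule.le_topologicalClosure _
      (Submodule.mem_map_of_mem (Ideal.mem_span_singleton.2 (dvd_mul_right D _)))
  · rw [mem_degreeLT, ← degree_eq_natDegree hD.ne_zero]
    exact degree_modByMonic_lt f hD

lemma rank_degreeLT {R : Type*} [Ring R] [StrongRankCondition R] (n : ℕ) :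
    Module.rank R (degreeLT R n) = n := by
  rw [(degreeLTEquiv R n).rank_eq, rank_fin_fun]

lemma rank_map_degreeLT_le (Φ : ℂ[X] →ₗ[ℂ] H) (n : ℕ) :
    Module.rank ℂ ((degreeLT ℂ n).map Φ) ≤ n := by
  simpa [rank_degreeLT] using lift_rank_map_le Φ (degreeLT ℂ n)

lemma eq_and_eq_of_le_add {c d : Cardinal} {a b N : ℕ} (hN : (N : Cardinal) ≤ c + d)
    (hc : c ≤ a) (hd : d ≤ b) (hab : a + b ≤ N) : c = a ∧ d = b := by
  obtain ⟨c, rfl⟩ := Cardinal.lt_aleph0.1 (hc.trans_lt Cardinal.natCast_lt_aleph0)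
  obtain ⟨d, rfl⟩ := Cardinal.lt_aleph0.1 (hd.trans_lt Cardinal.natCast_lt_aleph0)
  norm_cast at *
  omega

namespace IsHankelModel

lemma of_inner_apply_self (hΦ : DenseRange Φ)
    (hq : ∀ p, inner ℂ (Φ p) (G (Φ p)) = Λ (p * p.map (starRingEnd ℂ))) :
    IsHankelModel Φ G Λ := by
  refine ⟨hΦ, fun p r ↦ ?_⟩
  have h1 := hq (p + r)
  have h2 := hq (p + Complex.I • r)
  have hI : (Complex.I • r).map (starRingEnd ℂ) = (-Complex.I) • r.map (starRingEnd ℂ) := by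
    rw [smul_eq_C_mul, smul_eq_C_mul, Polynomial.map_mul, map_C, Complex.conj_I]
  simp only [map_add, Polynomial.map_add, inner_add_left, inner_add_right, mul_add, add_mul,
    hq p, hq r] at h1
  simp only [map_add, map_smul, hI, Polynomial.map_add, inner_add_left, inner_add_right, mul_add,
    add_mul, inner_smul_left, inner_smul_right, smul_mul_assoc, mul_smul_comm, smul_eq_mul,
    hq p, hq r, Complex.conj_I] at h2
  refine sub_eq_zero.1 ((mul_eq_zero.1 ?_).resolve_left Complex.I_ne_zero)
  linear_combination (1 / 2 : ℂ) * h2 + (1 / 2 : ℂ) * Complex.I * h1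

lemma neg (h : IsHankelModel Φ G Λ) : IsHankelModel Φ (-G) (-Λ) :=
  ⟨h.denseRange, fun p r ↦ by simp [h.inner_apply]⟩

lemma apply_map_conj (h : IsHankelModel Φ G Λ) (hG : (G : H →ₗ[ℂ] H).IsSymmetric) (f : ℂ[X]) :
    Λ (f.map (starRingEnd ℂ)) = conj (Λ f) := by
  have h1 := h.inner_apply 1 f
  have h2 := h.inner_apply f 1
  rw [Polynomial.map_one, mul_one] at h1
  rw [one_mul] at h2
  rw [← h1, ← h2, inner_conj_symm]
  exact (hG _ _).symm

lemma numNegEigenvalues_le_natDegree (h : IsHankelModel Φ G Λ)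
    (hG : (G : H →ₗ[ℂ] H).IsSymmetric) {D : ℂ[X]} (hD : D.Monic)
    (hnonneg : ∀ f, D ∣ f → 0 ≤ (Λ (f * f.map (starRingEnd ℂ))).re) :
    numNegEigenvalues G ≤ D.natDegree := by
  refine (numNegEigenvalues_le_rank hG ?_ (codisjoint_iff.2
    (closure_map_span_sup_map_degreeLT h.denseRange hD))).trans (rank_map_degreeLT_le Φ _)
  have hclosed : IsClosed {u : H | 0 ≤ (inner ℂ u (G u)).re} := by
    refine isClosed_le continuous_const (Complex.continuous_re.comp ?_)
    exact continuous_id.inner G.continuous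
  refine fun u hu ↦ closure_minimal ?_ hclosed hu
  rintro _ ⟨f, hf, rfl⟩
  rw [Set.mem_ofPred_eq, h.inner_apply]
  exact hnonneg f (Ideal.mem_span_singleton.1 hf)

lemma finiteDimensional_range (h : IsHankelModel Φ G Λ) {D : ℂ[X]} (hD : D.Monic)
    (hΛ : ∀ f, D ∣ f → Λ f = 0) : FiniteDimensional ℂ (LinearMap.range (G : H →ₗ[ℂ] H)) := by
  have : FiniteDimensional ℂ (degreeLT ℂ D.natDegree) :=
    (degreeLTEquiv ℂ D.natDegree).symm.finiteDimensional
  have hker : (((Ideal.span {D}).restrictScalars ℂ).map Φ).topologicalClosure ≤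
      LinearMap.ker (G : H →ₗ[ℂ] H) := by
    refine Submodule.topologicalClosure_minimal _ ?_ (ContinuousLinearMap.isClosed_ker G)
    rintro _ ⟨f, hf, rfl⟩
    refine h.denseRange.eq_zero_of_inner_right ℂ fun p ↦ (h.inner_apply p f).trans (hΛ _ ?_)
    exact (Ideal.mem_span_singleton.1 hf).mul_right _
  refine Submodule.finiteDimensional_of_le
    (S₂ := ((degreeLT ℂ D.natDegree).map Φ).map (G : H →ₗ[ℂ] H)) ?_
  rw [LinearMap.range_eq_map, ← closure_map_span_sup_map_degreeLT h.denseRange hD,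
    Submodule.map_sup, sup_le_iff]
  exact ⟨(LinearMap.le_ker_iff_map.1 hker).trans_le bot_le, le_rfl⟩

lemma natDegree_le_rank_range (h : IsHankelModel Φ G Λ) {D : ℂ[X]} (hD : D.Monic)
    (hΛ : ∀ f, (∀ g, Λ (f * g) = 0) → D ∣ f) :
    (D.natDegree : Cardinal) ≤ Module.rank ℂ (LinearMap.range (G : H →ₗ[ℂ] H)) := by
  let T : degreeLT ℂ D.natDegree →ₗ[ℂ] LinearMap.range (G : H →ₗ[ℂ] H) :=
    (G : H →ₗ[ℂ] H).rangeRestrict ∘ₗ Φ ∘ₗ (degreeLT ℂ D.natDegree).subtype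
  have hT : Function.Injective T := by
    rw [← LinearMap.ker_eq_bot, LinearMap.ker_eq_bot']
    rintro ⟨f, hf⟩ hTf
    have hGf : G (Φ f) = 0 := congrArg Subtype.val hTf
    have hdvd : D ∣ f := hΛ f fun g ↦ by
      simpa [hGf, Polynomial.map_map] using (h.inner_apply (g.map (starRingEnd ℂ)) f).symm
    refine Subtype.ext (eq_zero_of_dvd_of_degree_lt hdvd ?_)
    rw [degree_eq_natDegree hD.ne_zero]
    exact mem_degreeLT.1 hf
  simpa [rank_degreeLT] using LinearMap.lift_rank_le_of_injective T hT

variable {ι : Type*} {s : Finset ι} {z : ι → ℂ} {K : ι → ℕ} {Q : ι → ℂ[X]}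

lemma sum_le_numPosEigenvalues_add_numNegEigenvalues
    (h : IsHankelModel Φ G (residueSum s z K Q)) (hG : (G : H →ₗ[ℂ] H).IsSymmetric)
    (hz : Set.InjOn z s) (hQ : ∀ m ∈ s, (Q m).eval (z m) ≠ 0) :
    ((∑ m ∈ s, (K m + 1) : ℕ) : Cardinal) ≤ numPosEigenvalues G + numNegEigenvalues G := by
  have hD := monic_nodePolynomial s z (K · + 1)
  have := h.finiteDimensional_range hD fun _ ↦ residueSum_eq_zero_of_nodePolynomial_dvd Q
  rw [← natDegree_nodePolynomial s z (K · + 1)]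
  exact (h.natDegree_le_rank_range hD fun _ ↦
    nodePolynomial_dvd_of_forall_residueSum_mul_eq_zero hz hQ).trans
    (rank_range_le_numPosEigenvalues_add_numNegEigenvalues hG)

lemma numNegEigenvalues_le_sum
    (h : IsHankelModel Φ G (residueSum s z K Q)) (hG : (G : H →ₗ[ℂ] H).IsSymmetric)
    (hz : Set.InjOn z s) (hQ : ∀ m ∈ s, (Q m).eval (z m) ≠ 0) :
    numNegEigenvalues G ≤
      (∑ m ∈ s with (z m).im = 0, calNNeg (K m) ((Q m).eval (z m)).re +
        ∑ m ∈ s with 0 < (z m).im, (K m + 1) : ℕ) := by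
  rw [← sum_nodeExponent, ← natDegree_nodePolynomial s z]
  exact h.numNegEigenvalues_le_natDegree hG (monic_nodePolynomial ..) fun _ ↦
    re_residueSum_mul_map_conj_nonneg hz hQ (h.apply_map_conj hG)

lemma numPosEigenvalues_le_sum
    (h : IsHankelModel Φ G (residueSum s z K Q)) (hG : (G : H →ₗ[ℂ] H).IsSymmetric)
    (hz : Set.InjOn z s) (hQ : ∀ m ∈ s, (Q m).eval (z m) ≠ 0) :
    numPosEigenvalues G ≤
      (∑ m ∈ s with (z m).im = 0, calNPos (K m) ((Q m).eval (z m)).re +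
        ∑ m ∈ s with 0 < (z m).im, (K m + 1) : ℕ) := by
  have hneg : IsHankelModel Φ (-G) (residueSum s z K (-Q)) := residueSum_neg s z K Q ▸ h.neg
  have hGneg : ((-G : H →L[ℂ] H) : H →ₗ[ℂ] H).IsSymmetric := fun u v ↦ by simpa using hG u v
  have := hneg.numNegEigenvalues_le_sum hGneg hz (by simpa using hQ)
  simpa [numPosEigenvalues_eq_numNegEigenvalues_neg, calNNeg_neg] using this

theorem inertia
    (h : IsHankelModel Φ G (residueSum s z K Q)) (hG : (G : H →ₗ[ℂ] H).IsSymmetric)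
    (hz : Set.InjOn z s) (hQ : ∀ m ∈ s, (Q m).eval (z m) ≠ 0) :
    numPosEigenvalues G =
        (∑ m ∈ s with (z m).im = 0, calNPos (K m) ((Q m).eval (z m)).re +
          ∑ m ∈ s with 0 < (z m).im, (K m + 1) : ℕ) ∧
      numNegEigenvalues G =
        (∑ m ∈ s with (z m).im = 0, calNNeg (K m) ((Q m).eval (z m)).re +
          ∑ m ∈ s with 0 < (z m).im, (K m + 1) : ℕ) := by
  refine eq_and_eq_of_le_add (h.sum_le_numPosEigenvalues_add_numNegEigenvalues hG hz hQ)
    (h.numPosEigenvalues_le_sum hG hz hQ) (h.numNegEigenvalues_le_sum hG hz hQ) ?_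
  have sum_real_le : ∑ m ∈ s with (z m).im = 0, calNPos (K m) ((Q m).eval (z m)).re +
      ∑ m ∈ s with (z m).im = 0, calNNeg (K m) ((Q m).eval (z m)).re ≤
        ∑ m ∈ s with (z m).im = 0, (K m + 1) := by
    rw [← Finset.sum_add_distrib]
    exact Finset.sum_le_sum fun m _ ↦ calNPos_add_calNNeg_le _ _
  have := sum_add_one_eq_of_residueSum_map_conj hz hQ (h.apply_map_conj hG)
  omega

end IsHankelModel

end Model

section Circle

open Polynomial

lemma circleIntegral_eval_div_sub_pow {c z : ℂ} {r : ℝ} (hz : z ∈ Metric.ball c r) (F : ℂ[X])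
    (n : ℕ) :
    (∮ w in C(c, r), F.eval w / (w - z) ^ (n + 1)) =
      2 * Real.pi * Complex.I * (taylor z F).coeff n := by
  have hr : 0 < r := Metric.pos_of_mem_ball hz
  have sub_ne_zero : ∀ w ∈ Metric.sphere c r, w - z ≠ 0 := fun w hw ↦
    sub_ne_zero_of_ne (ne_of_mem_of_not_mem hw (Metric.mem_ball.1 hz).ne)
  have expand : Set.EqOn (fun w ↦ F.eval w / (w - z) ^ (n + 1))
      (fun w ↦ ∑ i ∈ (taylor z F).support, (taylor z F).coeff i * (w - z) ^ (i - (n + 1) : ℤ))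
      (Metric.sphere c r) := fun w hw ↦ by
    have eval_eq := taylor_eval z F (w - z)
    rw [sub_add_cancel, eval_eq_sum, sum_def] at eval_eq
    simp only [← eval_eq, Finset.sum_div, mul_div_assoc]
    refine Finset.sum_congr rfl fun i _ ↦ ?_
    rw [zpow_sub₀ (sub_ne_zero w hw)]
    norm_cast
  have integral_zpow : ∀ i : ℕ, (∮ w in C(c, r), (w - z) ^ (i - (n + 1) : ℤ)) =
      if n = i then 2 * Real.pi * Complex.I else 0 := fun i ↦ by
    split_ifs with hi
    · simpa [hi, zpow_neg_one] using circleIntegral.integral_sub_inv_of_mem_ball hz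
    · exact circleIntegral.integral_sub_zpow_of_ne (by omega) _ _ _
  rw [circleIntegral.integral_congr hr.le expand, circleIntegral.integral_fun_sum]
  · simp only [circleIntegral.integral_const_mul, integral_zpow]
    simp [mul_comm]
  · intro i _
    refine ContinuousOn.circleIntegrable hr.le (continuousOn_const.mul ?_)
    exact (continuousOn_id.sub continuousOn_const).zpow₀ _ fun w hw ↦ .inl (sub_ne_zero w hw)

lemma circleAverage_residue {z : ℂ} (hz : ‖z‖ < 1) (n : ℕ) (Q f : ℂ[X]) :
    Real.circleAverage (fun w ↦ w * Q.eval w / (w - z) ^ (n + 1) * f.eval w) 0 1 =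
      residueFunctional z n Q f := by
  have integrand_eq : Set.EqOn
      (fun w ↦ (w - 0)⁻¹ • (w * Q.eval w / (w - z) ^ (n + 1) * f.eval w))
      (fun w ↦ (Q * f).eval w / (w - z) ^ (n + 1)) (Metric.sphere 0 1) := fun w hw ↦ by
    have hw0 : w ≠ 0 := Metric.ne_of_mem_sphere hw one_ne_zero
    simp only [sub_zero, smul_eq_mul, eval_mul]
    field_simp
  rw [Real.circleAverage_eq_circleIntegral one_ne_zero,
    circleIntegral.integral_congr zero_le_one integrand_eq,
    circleIntegral_eval_div_sub_pow (by simpa using hz), smul_eq_mul,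
    inv_mul_cancel_left₀ Complex.two_pi_I_ne_zero, residueFunctional_apply]

lemma integral_toCircle_eq_circleAverage (F : ℂ → ℂ) :
    ∫ t : UnitAddCircle, F (toCircle t : ℂ) ∂haarAddCircle = Real.circleAverage F 0 1 := by
  rw [integral_haarAddCircle, ← UnitAddCircle.intervalIntegral_preimage 0, Real.circleAverage_def,
    inv_one, one_smul, zero_add]
  have rescale := intervalIntegral.integral_comp_mul_left (a := 0) (b := 1)
    (fun θ : ℝ ↦ F (circleMap 0 1 θ)) (c := 2 * Real.pi) (by positivity)
  rw [mul_zero, mul_one] at rescale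
  rw [← rescale]
  refine intervalIntegral.integral_congr fun x _ ↦ ?_
  simp [toCircle, Function.Periodic.lift_coe, circleMap]

/-- The restriction of polynomials to the unit circle `ℝ/ℤ`. -/
noncomputable def polynomialOnCircle : ℂ[X] →ₐ[ℂ] C(UnitAddCircle, ℂ) :=
  aeval (fourier 1)

lemma polynomialOnCircle_apply (f : ℂ[X]) (t : UnitAddCircle) :
    polynomialOnCircle f t = f.eval (toCircle t : ℂ) := by
  rw [polynomialOnCircle, aeval_continuousMap_apply, fourier_one]

lemma toLp_polynomialOnCircle_X_pow (n : ℕ) :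
    ContinuousMap.toLp 2 haarAddCircle ℂ (polynomialOnCircle (X ^ n)) = fourierLp (T := 1) 2 n := by
  rw [fourierLp]
  congr 1
  ext t
  rw [polynomialOnCircle_apply, eval_pow, eval_X, fourier_apply, natCast_zsmul, toCircle_nsmul,
    Circle.coe_pow]

lemma toLp_polynomialOnCircle_mem_hardyCircle (f : ℂ[X]) :
    ContinuousMap.toLp 2 haarAddCircle ℂ (polynomialOnCircle f) ∈ hardyCircle := by
  induction f using Polynomial.induction_on' with
  | add p q hp hq => simpa only [map_add] using hardyCircle.add_mem hp hq
  | monomial n a =>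
    rw [← C_mul_X_pow_eq_monomial, ← smul_eq_C_mul, map_smul, map_smul,
      toLp_polynomialOnCircle_X_pow]
    refine hardyCircle.smul_mem _ fun k hk ↦ ?_
    rw [fourierCoeff_eq_inner]
    exact orthonormal_fourier.2 (by omega)

/-- The boundary values of polynomials, as elements of the Hardy space. -/
noncomputable def polynomialToHardy : ℂ[X] →ₗ[ℂ] hardyCircle :=
  ((ContinuousMap.toLp 2 haarAddCircle ℂ).toLinearMap ∘ₗ
    polynomialOnCircle.toLinearMap).codRestrict hardyCircle toLp_polynomialOnCircle_mem_hardyCircle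

lemma polynomialToHardy_ae_eq (f : ℂ[X]) :
    ((polynomialToHardy f : L2Circle) : UnitAddCircle → ℂ) =ᵐ[haarAddCircle]
      fun t ↦ f.eval (toCircle t : ℂ) := by
  simp only [← polynomialOnCircle_apply]
  exact ContinuousMap.coeFn_toLp (p := 2) (𝕜 := ℂ) haarAddCircle (polynomialOnCircle f)

lemma denseRange_polynomialToHardy : DenseRange polynomialToHardy := by
  have topologicalClosure_range : (LinearMap.range polynomialToHardy).topologicalClosure = ⊤ := by
    rw [Submodule.topologicalClosure_eq_top_iff, Submodule.eq_bot_iff]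
    intro u hu
    rw [Submodule.mem_orthogonal] at hu
    refine Subtype.ext (fourierBasis.repr.injective ?_)
    ext n
    rw [fourierBasis_repr, ZeroMemClass.coe_zero, map_zero, lp.coeFn_zero, Pi.zero_apply]
    rcases lt_or_ge n 0 with hn | hn
    · exact u.2 n hn
    · obtain ⟨k, rfl⟩ := Int.eq_ofNat_of_zero_le hn
      rw [fourierCoeff_eq_inner, ← toLp_polynomialOnCircle_X_pow]
      exact hu _ ⟨X ^ k, rfl⟩
  have dense_range := Submodule.dense_iff_topologicalClosure_eq_top.2 topologicalClosure_range
  rwa [LinearMap.coe_range] at dense_range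

lemma IsHankelWithSymbol.inner_polynomialToHardy {ω : ℂ → ℂ} {G : hardyCircle →L[ℂ] hardyCircle}
    (hG : IsHankelWithSymbol ω G) (p : ℂ[X]) :
    inner ℂ (polynomialToHardy p) (G (polynomialToHardy p)) =
      Real.circleAverage (fun w ↦ ω w⁻¹ * (p * p.map (starRingEnd ℂ)).eval w) 0 1 := by
  rw [hG.form_eq, ← integral_toCircle_eq_circleAverage, ← integral_neg_eq_self _ haarAddCircle]
  refine integral_congr_ae ?_
  have ae_eq := polynomialToHardy_ae_eq p
  have ae_eq_neg := (Measure.measurePreserving_neg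
    (haarAddCircle : Measure UnitAddCircle)).quasiMeasurePreserving.ae_eq_comp ae_eq
  filter_upwards [ae_eq, ae_eq_neg] with t ht ht_neg
  have conj_eval : conj (p.eval (toCircle (-t) : ℂ)) =
      (p.map (starRingEnd ℂ)).eval (toCircle t : ℂ) := by
    rw [← eval_map_apply, toCircle_neg, Circle.coe_inv_eq_conj, Complex.conj_conj]
  simp only [Function.comp_apply, neg_neg] at ht_neg ⊢
  rw [ht, ht_neg, conj_eval, toCircle_neg, Circle.coe_inv, eval_mul, mul_assoc]

end Circle

section RationalSymbol

open Polynomial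

lemma circleIntegrable_residue {z : ℂ} (hz : ‖z‖ < 1) (n : ℕ) (Q f : ℂ[X]) :
    CircleIntegrable (fun w ↦ w * Q.eval w / (w - z) ^ (n + 1) * f.eval w) 0 1 := by
  refine ContinuousOn.circleIntegrable zero_le_one (.mul (.div (by fun_prop) (by fun_prop) ?_)
    f.continuousOn)
  intro w hw
  refine pow_ne_zero _ (sub_ne_zero.2 ?_)
  rintro rfl
  exact hz.ne (by simpa using hw)

lemma IsHankelWithSymbol.isHankelModel {ι : Type*} {s : Finset ι} {z : ι → ℂ} {K : ι → ℕ}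
    {Q : ι → ℂ[X]} {ω : ℂ → ℂ} {G : hardyCircle →L[ℂ] hardyCircle} (hG : IsHankelWithSymbol ω G)
    (hz : ∀ m ∈ s, ‖z m‖ < 1)
    (hω : ∀ w : ℂ, ‖w‖ = 1 →
      ω w⁻¹ = ∑ m ∈ s, w * (Q m).eval w / (w - z m) ^ (K m + 1)) :
    IsHankelModel polynomialToHardy G (residueSum s z K Q) := by
  refine .of_inner_apply_self denseRange_polynomialToHardy fun p ↦ ?_
  have integrand_eq : Set.EqOn (fun w ↦ ω w⁻¹ * (p * p.map (starRingEnd ℂ)).eval w)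
      (fun w ↦ ∑ m ∈ s, w * (Q m).eval w / (w - z m) ^ (K m + 1) *
        (p * p.map (starRingEnd ℂ)).eval w) (Metric.sphere 0 |1|) := fun w hw ↦ by
    simp only [hω w (by simpa using hw), Finset.sum_mul]
  rw [hG.inner_polynomialToHardy, Real.circleAverage_congr_sphere integrand_eq,
    Real.circleAverage_fun_sum fun m hm ↦ circleIntegrable_residue (hz m hm) _ _ _,
    residueSum_apply]
  exact Finset.sum_congr rfl fun m hm ↦ circleAverage_residue (hz m hm) _ _ _

lemma eval_reflect {k : Type*} [Field k] {P : k[X]} {n : ℕ} (hP : P.natDegree ≤ n) {w : k}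
    (hw : w ≠ 0) : (P.reflect n).eval w = P.eval w⁻¹ * w ^ n := by
  let := invertibleOfNonzero (inv_ne_zero hw)
  have h := eval₂_reflect_mul_pow (RingHom.id k) w⁻¹ n P hP
  rw [invOf_eq_inv, inv_inv, ← eval, ← eval] at h
  rw [← h, mul_assoc, ← mul_pow, inv_mul_cancel₀ hw, one_pow, mul_one]

/-- The pole of `w ↦ w⁻¹ ω(w⁻¹)` inside the unit disc which comes from the `m`-th term of the
rational symbol `ω`. -/
noncomputable def symbolNode (γ : ℕ → ℂ) (m : ℕ) : ℂ :=
  if m = 1 then 0 else (γ m)⁻¹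

/-- The numerator of the `m`-th term of `w⁻¹ ω(w⁻¹)` over the denominator
`(w - symbolNode γ m) ^ (K m + 1)`, where `ω` is a rational symbol. -/
noncomputable def symbolNumerator (K : ℕ → ℕ) (γ : ℕ → ℂ) (R : ℕ → ℂ[X]) (m : ℕ) : ℂ[X] :=
  C (if m = 1 then 1 else (-(γ m)⁻¹) ^ (K m + 1)) * (R m).reflect (K m)

variable {M M₀ M₁ m : ℕ} {K : ℕ → ℕ} {γ : ℕ → ℂ} {R : ℕ → ℂ[X]}

lemma one_le_firstRealIndex (R : ℕ → ℂ[X]) : 1 ≤ firstRealIndex R := by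
  unfold firstRealIndex
  split_ifs <;> omega

lemma firstRealIndex_le_two (R : ℕ → ℂ[X]) : firstRealIndex R ≤ 2 := by
  unfold firstRealIndex
  split_ifs <;> omega

lemma mem_Icc_two_of_mem_Icc_firstRealIndex (hm : m ∈ Finset.Icc (firstRealIndex R) M)
    (hm1 : m ≠ 1) : m ∈ Finset.Icc 2 M := by
  have := one_le_firstRealIndex R
  rw [Finset.mem_Icc] at hm ⊢
  omega

lemma ne_zero_of_one_mem_Icc_firstRealIndex (h : 1 ∈ Finset.Icc (firstRealIndex R) M) :
    R 1 ≠ 0 := fun hR ↦ by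
  simp [firstRealIndex, hR] at h

lemma sum_Icc_firstRealIndex {A : Type*} [AddCommMonoid A] (hM : 1 ≤ M) {a : ℕ → A}
    (ha : R 1 = 0 → a 1 = 0) :
    ∑ m ∈ Finset.Icc (firstRealIndex R) M, a m = a 1 + ∑ m ∈ Finset.Icc 2 M, a m := by
  by_cases h : R 1 = 0
  · simp [firstRealIndex, h, ha h]
  · rw [firstRealIndex, if_neg h, ← Finset.add_sum_Ioc_eq_sum_Icc hM]
    rfl

lemma norm_symbolNode_lt_one (hγ : ∀ m ∈ Finset.Icc 2 M, 1 < ‖γ m‖)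
    (hm : m ∈ Finset.Icc (firstRealIndex R) M) : ‖symbolNode γ m‖ < 1 := by
  rw [symbolNode]
  split_ifs with h1
  · simp
  · rw [norm_inv]
    exact inv_lt_one_of_one_lt₀ (hγ m (mem_Icc_two_of_mem_Icc_firstRealIndex hm h1))

lemma injOn_symbolNode (hγ : ∀ m ∈ Finset.Icc 2 M, γ m ≠ 0) (hγ_inj : Set.InjOn γ (Set.Icc 2 M)) :
    Set.InjOn (symbolNode γ) (Finset.Icc (firstRealIndex R) M) := by
  intro i hi j hj hij
  have hi2 := mem_Icc_two_of_mem_Icc_firstRealIndex hi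
  have hj2 := mem_Icc_two_of_mem_Icc_firstRealIndex hj
  rw [symbolNode, symbolNode] at hij
  split_ifs at hij with hi1 hj1 hj1
  · rw [hi1, hj1]
  · exact absurd (inv_eq_zero.1 hij.symm) (hγ j (hj2 hj1))
  · exact absurd (inv_eq_zero.1 hij) (hγ i (hi2 hi1))
  · exact hγ_inj (Finset.mem_Icc.1 (hi2 hi1)) (Finset.mem_Icc.1 (hj2 hj1)) (inv_injective hij)

lemma im_symbolNode_eq_zero_iff (hm : m ≠ 1) : (symbolNode γ m).im = 0 ↔ (γ m).im = 0 := by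
  rw [symbolNode, if_neg hm, ← Complex.conj_eq_iff_im, ← Complex.conj_eq_iff_im, map_inv₀, inv_inj]

lemma im_symbolNode_pos_iff (hm : m ≠ 1) : 0 < (symbolNode γ m).im ↔ (γ m).im < 0 := by
  rw [symbolNode, if_neg hm, Complex.inv_im]
  rcases eq_or_ne (γ m) 0 with h | h
  · simp [h]
  · rw [div_pos_iff_of_pos_right (Complex.normSq_pos.2 h), neg_pos]

lemma rationalSymbol_inv (hM : 1 ≤ M) (hK₁ : (R 1).natDegree ≤ K 1)
    (hγ : ∀ m ∈ Finset.Icc 2 M, γ m ≠ 0)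
    (hdeg : ∀ m ∈ Finset.Icc 2 M, (R m).natDegree ≤ K m) {w : ℂ} (hw : w ≠ 0) :
    rationalSymbol M K γ R w⁻¹ = ∑ m ∈ Finset.Icc (firstRealIndex R) M,
      w * (symbolNumerator K γ R m).eval w / (w - symbolNode γ m) ^ (K m + 1) := by
  rw [rationalSymbol, sum_Icc_firstRealIndex hM fun h ↦ by simp [symbolNumerator, h]]
  congr 1
  · simp only [symbolNumerator, symbolNode, if_true, map_one, one_mul, sub_zero,
      eval_reflect hK₁ hw]
    field_simp
    ring
  · refine Finset.sum_congr rfl fun m hm ↦ ?_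
    have hm1 : m ≠ 1 := by
      rw [Finset.mem_Icc] at hm
      omega
    have sub_eq : w⁻¹ - γ m = (-(γ m)⁻¹)⁻¹ * w⁻¹ * (w - (γ m)⁻¹) := by
      have := hγ m hm
      field_simp
      ring
    simp only [symbolNumerator, symbolNode, if_neg hm1, eval_mul, eval_C,
      eval_reflect (hdeg m hm) hw, sub_eq, mul_pow, mul_inv, inv_pow, inv_inv]
    rw [div_eq_mul_inv]
    ring

lemma IsHankelWithSymbol.isHankelModel_rationalSymbol {G : hardyCircle →L[ℂ] hardyCircle}
    (hG : IsHankelWithSymbol (rationalSymbol M K γ R) G) (hM : 1 ≤ M)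
    (hK₁ : (R 1).natDegree ≤ K 1) (hγ : ∀ m ∈ Finset.Icc 2 M, 1 < ‖γ m‖)
    (hdeg : ∀ m ∈ Finset.Icc 2 M, (R m).natDegree ≤ K m) :
    IsHankelModel polynomialToHardy G (residueSum (Finset.Icc (firstRealIndex R) M)
      (symbolNode γ) K (symbolNumerator K γ R)) :=
  hG.isHankelModel (fun _ ↦ norm_symbolNode_lt_one hγ) fun _ hw ↦
    rationalSymbol_inv hM hK₁ (fun m hm ↦ norm_pos_iff.1 (zero_lt_one.trans (hγ m hm))) hdeg
      (norm_ne_zero_iff.1 (hw ▸ one_ne_zero))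

lemma eval_symbolNumerator_one (K : ℕ → ℕ) (γ : ℕ → ℂ) (R : ℕ → ℂ[X]) :
    (symbolNumerator K γ R 1).eval (symbolNode γ 1) = (R 1).coeff (K 1) := by
  simp [symbolNumerator, symbolNode, ← coeff_zero_eq_eval_zero, coeff_reflect]

lemma eval_symbolNumerator_of_ne_one (hm1 : m ≠ 1) (hγ : γ m ≠ 0)
    (hdeg : (R m).natDegree ≤ K m) :
    (symbolNumerator K γ R m).eval (symbolNode γ m) =
      (-(γ m)⁻¹) ^ (K m + 1) * (γ m)⁻¹ ^ K m * (R m).eval (γ m) := by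
  rw [symbolNumerator, symbolNode, if_neg hm1, if_neg hm1, eval_mul, eval_C,
    eval_reflect hdeg (inv_ne_zero hγ), inv_inv]
  ring

lemma eval_symbolNumerator_ne_zero (hK₁ : K 1 = (R 1).natDegree)
    (hγ : ∀ m ∈ Finset.Icc 2 M, γ m ≠ 0)
    (hdeg : ∀ m ∈ Finset.Icc 2 M, (R m).natDegree ≤ K m)
    (hR : ∀ m ∈ Finset.Icc 2 M, (R m).eval (γ m) ≠ 0)
    (hm : m ∈ Finset.Icc (firstRealIndex R) M) :
    (symbolNumerator K γ R m).eval (symbolNode γ m) ≠ 0 := by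
  rcases eq_or_ne m 1 with rfl | hm1
  · rw [eval_symbolNumerator_one, hK₁, coeff_natDegree, leadingCoeff_ne_zero]
    exact ne_zero_of_one_mem_Icc_firstRealIndex hm
  · have hm2 := mem_Icc_two_of_mem_Icc_firstRealIndex hm hm1
    rw [eval_symbolNumerator_of_ne_one hm1 (hγ m hm2) (hdeg m hm2)]
    simp [hγ m hm2, hR m hm2]

lemma leadingNumber_one (K : ℕ → ℕ) (γ : ℕ → ℂ) (R : ℕ → ℂ[X]) :
    leadingNumber K γ R 1 = (K 1).factorial * ((R 1).coeff (K 1)).re := by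
  rw [leadingNumber, if_pos rfl, ← coeff_zero_eq_eval_zero, coeff_iterate_derivative, zero_add,
    Nat.descFactorial_self, nsmul_eq_mul, ← Complex.ofReal_natCast, Complex.re_ofReal_mul]

lemma inv_pow_eq_abs_inv_pow_mul_sign {n : ℕ} (hn : Odd n) (x : ℝ) :
    x⁻¹ ^ n = |x|⁻¹ ^ n * Real.sign x := by
  rcases lt_trichotomy x 0 with hx | rfl | hx
  · rw [abs_of_neg hx, Real.sign_of_neg hx, inv_neg, hn.neg_pow]
    ring
  · simp [hn.pos.ne']
  · rw [abs_of_pos hx, Real.sign_of_pos hx, mul_one]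

lemma exists_pos_re_eval_symbolNumerator_eq_mul_leadingNumber
    (hγ : ∀ m ∈ Finset.Icc 2 M, γ m ≠ 0)
    (hdeg : ∀ m ∈ Finset.Icc 2 M, (R m).natDegree ≤ K m)
    (hm : m ∈ Finset.Icc (firstRealIndex R) M) (him : (symbolNode γ m).im = 0)
    (hK : Even (K m)) :
    ∃ r : ℝ, 0 < r ∧
      ((symbolNumerator K γ R m).eval (symbolNode γ m)).re = r * leadingNumber K γ R m := by
  rcases eq_or_ne m 1 with rfl | hm1
  · refine ⟨((K 1).factorial : ℝ)⁻¹, by positivity, ?_⟩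
    rw [eval_symbolNumerator_one, leadingNumber_one, inv_mul_cancel_left₀ (by positivity)]
  · have hm2 := mem_Icc_two_of_mem_Icc_firstRealIndex hm hm1
    have hγ0 := hγ m hm2
    obtain ⟨x, hx⟩ := Complex.canLift.prf (γ m) ((im_symbolNode_eq_zero_iff hm1).1 him)
    have hx0 : x ≠ 0 := by
      rintro rfl
      exact hγ0 (by simp [← hx])
    have coeff_eq : (-(γ m)⁻¹) ^ (K m + 1) * (γ m)⁻¹ ^ K m = ((-x⁻¹ ^ (2 * K m + 1) : ℝ) : ℂ) := by
      rw [hK.add_one.neg_pow, ← hx]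
      push_cast
      ring
    refine ⟨|x|⁻¹ ^ (2 * K m + 1), by positivity, ?_⟩
    rw [eval_symbolNumerator_of_ne_one hm1 hγ0 (hdeg m hm2), coeff_eq, Complex.re_ofReal_mul,
      leadingNumber, if_neg hm1, inv_pow_eq_abs_inv_pow_mul_sign ⟨K m, rfl⟩, ← hx,
      Complex.ofReal_re]
    ring

lemma calNPos_congr {n : ℕ} {p q : ℝ} (h : Even n → ∃ r : ℝ, 0 < r ∧ p = r * q) :
    calNPos n p = calNPos n q := by
  rcases n.even_or_odd with hn | hn
  · obtain ⟨r, hr, rfl⟩ := h hn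
    simp only [calNPos, mul_pos_iff_of_pos_left hr]
  · simp only [calNPos, hn, if_true]

lemma calNNeg_congr {n : ℕ} {p q : ℝ} (h : Even n → ∃ r : ℝ, 0 < r ∧ p = r * q) :
    calNNeg n p = calNNeg n q := by
  rw [← neg_neg p, ← neg_neg q, calNNeg_neg, calNNeg_neg]
  refine calNPos_congr fun hn ↦ ?_
  obtain ⟨r, hr, rfl⟩ := h hn
  exact ⟨r, hr, by ring⟩

lemma filter_im_symbolNode_eq_zero (hM₀ : 1 ≤ M₀) (hM : M₀ ≤ M)
    (hreal : ∀ m ∈ Finset.Icc 2 M₀, (γ m).im = 0)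
    (hne : ∀ m ∈ Finset.Icc (M₀ + 1) M, (γ m).im ≠ 0) :
    {m ∈ Finset.Icc (firstRealIndex R) M | (symbolNode γ m).im = 0} =
      Finset.Icc (firstRealIndex R) M₀ := by
  ext m
  have := one_le_firstRealIndex R
  have im_one : (symbolNode γ 1).im = 0 := by simp [symbolNode]
  have im_iff := im_symbolNode_eq_zero_iff (γ := γ) (m := m)
  grind

lemma filter_im_symbolNode_pos (hM₀ : 1 ≤ M₀) (hM : M₀ + M₁ ≤ M)
    (hreal : ∀ m ∈ Finset.Icc 2 M₀, (γ m).im = 0)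
    (hneg : ∀ m ∈ Finset.Icc (M₀ + 1) (M₀ + M₁), (γ m).im < 0)
    (hpos : ∀ m ∈ Finset.Icc (M₀ + M₁ + 1) M, 0 < (γ m).im) :
    {m ∈ Finset.Icc (firstRealIndex R) M | 0 < (symbolNode γ m).im} =
      Finset.Icc (M₀ + 1) (M₀ + M₁) := by
  ext m
  have := one_le_firstRealIndex R
  have := firstRealIndex_le_two R
  have im_one : (symbolNode γ 1).im = 0 := by simp [symbolNode]
  have im_iff := im_symbolNode_pos_iff (γ := γ) (m := m)
  grind

end RationalSymbol

theorem theorem5p3 (M M₀ M₁ : ℕ) (K : ℕ → ℕ) (γ : ℕ → ℂ) (R : ℕ → ℂ[X])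
    (hM₀ : 1 ≤ M₀) (hM : M₀ + M₁ ≤ M)
    (hK₁ : K 1 = (R 1).natDegree)
    (hγ : ∀ m ∈ Finset.Icc 2 M, 1 < ‖γ m‖)
    (hγ_inj : Set.InjOn γ (Set.Icc 2 M))
    (hdeg : ∀ m ∈ Finset.Icc 2 M, (R m).natDegree ≤ K m)
    (hR : ∀ m ∈ Finset.Icc 2 M, (R m).eval (γ m) ≠ 0)
    (hreal : ∀ m ∈ Finset.Icc 2 M₀, (γ m).im = 0)
    (hneg : ∀ m ∈ Finset.Icc (M₀ + 1) (M₀ + M₁), (γ m).im < 0)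
    (hpos : ∀ m ∈ Finset.Icc (M₀ + M₁ + 1) M, 0 < (γ m).im)
    (G : hardyCircle →L[ℂ] hardyCircle)
    (hG : IsHankelWithSymbol (rationalSymbol M K γ R) G)
    (hsa : IsSelfAdjoint G) :
    numPosEigenvalues G =
        ((∑ m ∈ Finset.Icc (firstRealIndex R) M₀, calNPos (K m) (leadingNumber K γ R m)
          + ∑ m ∈ Finset.Icc (M₀ + 1) (M₀ + M₁), K m + M₁ : ℕ) : Cardinal) ∧
      numNegEigenvalues G =
        ((∑ m ∈ Finset.Icc (firstRealIndex R) M₀, calNNeg (K m) (leadingNumber K γ R m)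
          + ∑ m ∈ Finset.Icc (M₀ + 1) (M₀ + M₁), K m + M₁ : ℕ) : Cardinal) := by
  have hγ0 : ∀ m ∈ Finset.Icc 2 M, γ m ≠ 0 := fun m hm ↦
    norm_pos_iff.1 (zero_lt_one.trans (hγ m hm))
  have hne : ∀ m ∈ Finset.Icc (M₀ + 1) M, (γ m).im ≠ 0 := by grind
  have inertia := (hG.isHankelModel_rationalSymbol (by omega) hK₁.ge hγ hdeg).inertia
    hsa.isSymmetric (injOn_symbolNode hγ0 hγ_inj)
    fun _ ↦ eval_symbolNumerator_ne_zero hK₁ hγ0 hdeg hR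
  have sign : ∀ m ∈ {m ∈ Finset.Icc (firstRealIndex R) M | (symbolNode γ m).im = 0},
      Even (K m) → ∃ r : ℝ, 0 < r ∧
        ((symbolNumerator K γ R m).eval (symbolNode γ m)).re = r * leadingNumber K γ R m :=
    fun m hm ↦ exists_pos_re_eval_symbolNumerator_eq_mul_leadingNumber hγ0 hdeg
      (Finset.mem_filter.1 hm).1 (Finset.mem_filter.1 hm).2
  have sum_add_one : ∑ m ∈ Finset.Icc (M₀ + 1) (M₀ + M₁), (K m + 1) =
      ∑ m ∈ Finset.Icc (M₀ + 1) (M₀ + M₁), K m + M₁ := by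
    simp only [Finset.sum_add_distrib, Finset.sum_const, Nat.card_Icc, smul_eq_mul]
    omega
  rwa [Finset.sum_congr rfl fun m hm ↦ calNPos_congr (sign m hm),
    Finset.sum_congr rfl fun m hm ↦ calNNeg_congr (sign m hm),
    filter_im_symbolNode_eq_zero hM₀ (by omega) hreal hne,
    filter_im_symbolNode_pos hM₀ hM hreal hneg hpos, sum_add_one, ← add_assoc,
    ← add_assoc] at inertia
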